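/- Let $c$ be a real constant. Then there is a function $f=f_c:\mathbb N\to\mathbb R$ with $f(n)=o(n^2)$ as $n\to\infty$ such that the following holds. Let $n\ge 2$ be even and let $G$ be an $n/2$-regular simple graph on $n$ vertices. Suppose that the second largest eigenvalue $\lambda_2(G)$ of its adjacency matrix (eigenvalues counted with multiplicity, $\lambda_1\ge\lambda_2\ge\dots\ge\lambda_n$) satisfies $\lambda_2(G)\le c$. Then, after a suitable labeling of the vertices of $G$ by the vertices of the complete bipartite graph $K_{n/2,n/2}$, $$|E(G)\,\triangle\,E(K_{n/2,n/2})|\le f(n).$$ -/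

import Mathlib

open Filter Asymptotics
open scoped symmDiff

/-- The second largest eigenvalue, counted with multiplicity, of the adjacency matrix of a
graph with at least two vertices: the entry of index `1` in the list
`λ₁ ≥ λ₂ ≥ … ≥ λₙ` of all eigenvalues (indexed from `0`). -/
noncomputable def secondEigenvalue {V : Type*} [Fintype V] [DecidableEq V]
    (G : SimpleGraph V) [DecidableRel G.Adj] (h : 1 < Fintype.card V) : ℝ :=
  (G.isHermitian_adjMatrix ℝ).eigenvalues₀ ⟨1, h⟩

/-- The number of pairs in which the edge sets of `G` and `H` differ, once the vertices of `G`
are labeled by those of `H` through the bijection `e`: the size of `E(G) ∆ E(H)`. -/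
noncomputable def edgeDifference {V W : Type*} (G : SimpleGraph V) (H : SimpleGraph W)
    (e : V ≃ W) : ℕ :=
  (G.edgeSet ∆ (H.comap e).edgeSet).ncard

/-! ### Spectral expansions in coordinates. -/

section Spectral

open Matrix Finset

variable {ι : Type*} [Fintype ι] [DecidableEq ι]

/-! Let `S = J - 2A`, a sign matrix. As `A` is `n/2`-regular, the all-ones vector lies in the kernel
of `S`, and `λ₂ ≤ c` makes `M = S + C·I` positive semidefinite for `C = 2|c|`, once `n > 2c`. Its
trace is `n(1 + C)` and its squared Frobenius norm is `n² + O(n)`. The key bound is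
`sum_le_of_card_le`: the boundedly many eigenvalues of size at least `εn` sum to at most `(1 + ε)n`,
without the factor `1 + C`. The small ones contribute `O(εn²)` to the Frobenius norm, so the top
eigenvalue is nearly `n` and `M` is nearly of rank one (`exists_rank_one_sign_approx`). The signs of
the top eigenvector split the vertices into two parts, which regularity forces to be almost equal.
-/

theorem Matrix.IsHermitian.sum_eigenvectorBasis_mul_eigenvectorBasis {A : Matrix ι ι ℝ}
    (hA : A.IsHermitian) (l m : ι) :
    ∑ i, hA.eigenvectorBasis l i * hA.eigenvectorBasis m i = if l = m then 1 else 0 := by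
  have h := congrFun (congrFun (Unitary.coe_star_mul_self hA.eigenvectorUnitary) l) m
  simpa [Matrix.mul_apply, Matrix.star_apply, Matrix.one_apply] using h

theorem Matrix.IsHermitian.sum_eigenvectorBasis_apply_mul_apply {A : Matrix ι ι ℝ}
    (hA : A.IsHermitian) (i j : ι) :
    ∑ l, hA.eigenvectorBasis l i * hA.eigenvectorBasis l j = if i = j then 1 else 0 := by
  have h := congrFun (congrFun (Unitary.coe_mul_star_self hA.eigenvectorUnitary) i) j
  simpa [Matrix.mul_apply, Matrix.star_apply, Matrix.one_apply] using h

theorem Matrix.IsHermitian.apply_eq_sum_eigenvalues {A : Matrix ι ι ℝ}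
    (hA : A.IsHermitian) (i j : ι) :
    A i j = ∑ l, hA.eigenvalues l * (hA.eigenvectorBasis l i * hA.eigenvectorBasis l j) := by
  have h := congrFun (congrFun hA.spectral_theorem i) j
  rw [Unitary.conjStarAlgAut_apply] at h
  rw [h, Matrix.mul_apply]
  refine Finset.sum_congr rfl fun l _ => ?_
  rw [Matrix.mul_diagonal]
  simp [Matrix.star_apply]
  ring

theorem sum_sq_sum_mul_of_orthonormal {u : ι → ι → ℝ}
    (hu : ∀ l m, ∑ i, u l i * u m i = if l = m then 1 else 0) (a : ι → ℝ) :
    ∑ i, ∑ j, (∑ l, a l * (u l i * u l j)) ^ 2 = ∑ l, a l ^ 2 := by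
  calc ∑ i, ∑ j, (∑ l, a l * (u l i * u l j)) ^ 2
      = ∑ i, ∑ j, ∑ l, ∑ m, a l * a m * ((u l i * u m i) * (u l j * u m j)) := by
        refine Finset.sum_congr rfl fun i _ => Finset.sum_congr rfl fun j _ => ?_
        rw [sq, Finset.sum_mul_sum]
        refine Finset.sum_congr rfl fun l _ => Finset.sum_congr rfl fun m _ => ?_
        ring
    _ = ∑ l, ∑ m, ∑ i, ∑ j, a l * a m * ((u l i * u m i) * (u l j * u m j)) := by
        simp only [← Fintype.sum_prod_type']
        exact Fintype.sum_equiv ⟨fun x => (x.2.2.1, x.2.2.2, x.1, x.2.1),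
          fun x => (x.2.2.1, x.2.2.2, x.1, x.2.1), fun _ => rfl, fun _ => rfl⟩ _ _ fun _ => rfl
    _ = ∑ l, ∑ m, a l * a m * ((∑ i, u l i * u m i) * (∑ j, u l j * u m j)) := by
        refine Finset.sum_congr rfl fun l _ => Finset.sum_congr rfl fun m _ => ?_
        rw [Finset.sum_mul_sum, Finset.mul_sum]
        exact Finset.sum_congr rfl fun i _ => (Finset.mul_sum _ _ _).symm
    _ = ∑ l, a l ^ 2 := by
        simp [hu, sq]

theorem sum_diag_of_orthonormal {u : ι → ι → ℝ}
    (hu : ∀ l m, ∑ i, u l i * u m i = if l = m then 1 else 0) (a : ι → ℝ) (s : Finset ι) :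
    ∑ i, ∑ l ∈ s, a l * (u l i * u l i) = ∑ l ∈ s, a l := by
  rw [Finset.sum_comm]
  refine Finset.sum_congr rfl fun l _ => ?_
  rw [← Finset.mul_sum, hu, if_pos rfl, mul_one]

end Spectral

/-! ### The positive semidefinite matrix of a regular graph. -/

section Graph

open Matrix Finset

variable {V : Type*} [Fintype V] [DecidableEq V]

theorem eigenvalues_le_secondEigenvalue (G : SimpleGraph V) [DecidableRel G.Adj]
    (h : 1 < Fintype.card V) :
    ∃ l₀ : V, ∀ l ≠ l₀, (G.isHermitian_adjMatrix ℝ).eigenvalues l ≤ secondEigenvalue G h := by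
  -- This is the reindexing inside `eigenvalues`, so antitonicity of `eigenvalues₀` applies
  -- definitionally.
  set e := Fintype.equivOfCardEq (α := Fin (Fintype.card V)) (β := V) (Fintype.card_fin _)
  refine ⟨e ⟨0, by omega⟩, fun l hl => ?_⟩
  refine (G.isHermitian_adjMatrix ℝ).eigenvalues₀_antitone ?_
  have : e.symm l ≠ ⟨0, by omega⟩ := fun h' => hl (by rw [← h', Equiv.apply_symm_apply])
  rw [Fin.le_def]
  rw [Ne, Fin.ext_iff] at this
  exact Nat.one_le_iff_ne_zero.2 this

/-- The Seidel-type matrix `J - 2A + C` of a regular graph of degree `|V| / 2` with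
`λ₂ ≤ c < |V| / 2` and `2c ≤ C` has an orthonormal system of eigenvectors
with nonnegative eigenvalues. -/
theorem exists_spectral_decomposition_of_secondEigenvalue_le (G : SimpleGraph V)
    [DecidableRel G.Adj] (h : 1 < Fintype.card V) {d : ℕ} (hd : 2 * d = Fintype.card V)
    (hG : G.IsRegularOfDegree d) {c C : ℝ} (hc : secondEigenvalue G h ≤ c) (hcd : c < d)
    (hC : 0 ≤ C) (hcC : 2 * c ≤ C) :
    ∃ (μ : V → ℝ) (u : V → V → ℝ), (∀ l, 0 ≤ μ l) ∧
      (∀ l m, ∑ i, u l i * u m i = if l = m then 1 else 0) ∧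
      ∀ i j, 1 - 2 * G.adjMatrix ℝ i j + (if i = j then C else 0) =
        ∑ l, μ l * (u l i * u l j) := by
  set hA := G.isHermitian_adjMatrix ℝ
  obtain ⟨l₀, hl₀⟩ := eigenvalues_le_secondEigenvalue G h
  set u : V → V → ℝ := fun l i => hA.eigenvectorBasis l i with hu
  have horth : ∀ l m, ∑ i, u l i * u m i = if l = m then 1 else 0 :=
    hA.sum_eigenvectorBasis_mul_eigenvectorBasis
  have hcomp : ∀ i j, ∑ l, u l i * u l j = if i = j then 1 else 0 :=
    hA.sum_eigenvectorBasis_apply_mul_apply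
  have hs : ∀ l, (d : ℝ) * ∑ i, u l i = hA.eigenvalues l * ∑ i, u l i := by
    intro l
    have h1 := hA.mulVec_eigenvectorBasis l
    have h2 : ∀ i, ∑ j, G.adjMatrix ℝ i j * u l j = hA.eigenvalues l * u l i := fun i => by
      have := congrFun h1 i
      simpa [Matrix.mulVec, dotProduct] using this
    rw [Finset.mul_sum, Finset.mul_sum, ← Finset.sum_congr rfl fun i _ => h2 i,
      Finset.sum_comm]
    refine Finset.sum_congr rfl fun j _ => ?_
    rw [← Finset.sum_mul]
    congr 1
    have h3 := hG j
    simp only [SimpleGraph.adjMatrix_apply, Finset.sum_boole]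
    rw [← h3, ← SimpleGraph.card_neighborFinset_eq_degree]
    congr 2
    ext i
    simp [SimpleGraph.adj_comm]
  have hs0 : ∀ l ≠ l₀, ∑ i, u l i = 0 := by
    intro l hl
    have h1 := hl₀ l hl
    by_contra h2
    have h3 := mul_right_cancel₀ h2 (hs l)
    linarith
  -- Expanding the all-ones vector in the eigenbasis leaves only the `l₀` term, so `u l₀` is
  -- constant.
  have hone : ∀ i, (∑ j, u l₀ j) * u l₀ i = 1 := by
    intro i
    have h1 : ∑ j, ∑ l, u l j * u l i = 1 := by simp [hcomp]
    rw [Finset.sum_comm] at h1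
    simp only [← Finset.sum_mul] at h1
    rwa [Finset.sum_eq_single l₀ (fun l _ hl => by rw [hs0 l hl, zero_mul]) (by simp)] at h1
  have hcard : (∑ j, u l₀ j) ^ 2 = 2 * d := by
    have h1 : ∑ i, (∑ j, u l₀ j) * u l₀ i = Fintype.card V := by simp [hone]
    rw [← Finset.mul_sum] at h1
    rw [sq, h1, ← hd]
    push_cast
    ring
  have hev : hA.eigenvalues l₀ = d := by
    have h1 := hs l₀
    have h2 : ∑ j, u l₀ j ≠ 0 := by
      intro h2
      obtain ⟨i⟩ : Nonempty V := Fintype.card_pos_iff.1 (by omega)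
      simpa [h2] using hone i
    exact (mul_right_cancel₀ h2 h1).symm
  -- `J` has the single nonzero eigenvalue `2d`, at `u l₀`, where it cancels `-2d` from `-2A`.
  refine ⟨fun l => C - 2 * hA.eigenvalues l + if l = l₀ then 2 * (d : ℝ) else 0, u, fun l => ?_,
    horth, fun i j => ?_⟩
  · by_cases hl : l = l₀
    · subst hl
      simp only [if_true]
      rw [hev]
      linarith
    · simp only [hl, if_false]
      linarith [hl₀ l hl]
  · have h1 : G.adjMatrix ℝ i j = ∑ l, hA.eigenvalues l * (u l i * u l j) :=
      hA.apply_eq_sum_eigenvalues i j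
    have h2 : (1 : ℝ) = 2 * d * (u l₀ i * u l₀ j) := by
      rw [← hcard]
      linear_combination -hone i - (∑ j, u l₀ j) * u l₀ i * hone j
    have h3 : ∑ l, (if l = l₀ then 2 * (d : ℝ) else 0) * (u l i * u l j) = 1 := by
      rw [h2]
      simp [ite_mul]
    have h4 := hcomp i j
    simp only [add_mul, sub_mul, Finset.sum_add_distrib, Finset.sum_sub_distrib, mul_assoc]
      at h3 ⊢
    rw [h3, ← Finset.mul_sum, ← Finset.mul_sum, ← h1, h4]
    split_ifs <;> ring

end Graph

/-! ### The sum of the large eigenvalues. -/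

section LargeEigenvalues

open Finset

variable {ι : Type*} [Fintype ι] [DecidableEq ι]

/-- For the vectors `x i = (√(μ l) * u l i)` with `l ∈ B`, `#Q · ∑ |x i|²` equals `|∑ x i|²` plus
half the sum of all squared distances. The first term is at most the sum of the entries of `M` over
`Q × Q`, in which `C` occurs only `#Q` times; dividing by `#Q` leaves one `C` per cluster. -/
theorem sum_diag_le_of_close {μ : ι → ℝ} {u : ι → ι → ℝ} {B Q : Finset ι} {C ε : ℝ} (hC : 0 ≤ C)
    (hμ : ∀ l, 0 ≤ μ l)
    (hM : ∀ i j, ∑ l, μ l * (u l i * u l j) ≤ 1 + if i = j then C else 0)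
    (hQ : ∀ i ∈ Q, ∀ j ∈ Q, ∑ l ∈ B, μ l * (u l i - u l j) ^ 2 ≤ ε) :
    ∑ i ∈ Q, ∑ l ∈ B, μ l * (u l i * u l i) ≤ #Q * (1 + ε / 2) + C := by
  rcases Q.eq_empty_or_nonempty with rfl | hne
  · simpa using hC
  have hpos : (0 : ℝ) < #Q := by exact_mod_cast hne.card_pos
  set T := ∑ i ∈ Q, ∑ l ∈ B, μ l * (u l i * u l i) with hT
  have hfull : ∑ i ∈ Q, ∑ j ∈ Q, ∑ l ∈ B, μ l * (u l i * u l j) ≤ (#Q : ℝ) ^ 2 + #Q * C := by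
    have hswap : ∀ s : Finset ι, ∑ i ∈ Q, ∑ j ∈ Q, ∑ l ∈ s, μ l * (u l i * u l j) =
        ∑ l ∈ s, μ l * (∑ i ∈ Q, u l i) ^ 2 := by
      intro s
      rw [Finset.sum_congr rfl fun i _ => Finset.sum_comm, Finset.sum_comm]
      refine Finset.sum_congr rfl fun l _ => ?_
      rw [sq, Finset.sum_mul_sum, Finset.mul_sum]
      exact Finset.sum_congr rfl fun i _ => (Finset.mul_sum _ _ _).symm
    calc ∑ i ∈ Q, ∑ j ∈ Q, ∑ l ∈ B, μ l * (u l i * u l j)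
        ≤ ∑ i ∈ Q, ∑ j ∈ Q, ∑ l, μ l * (u l i * u l j) := by
          rw [hswap, hswap]
          exact Finset.sum_le_sum_of_subset_of_nonneg (Finset.subset_univ _)
            fun l _ _ => mul_nonneg (hμ l) (sq_nonneg _)
      _ ≤ ∑ i ∈ Q, ∑ j ∈ Q, (1 + if i = j then C else 0) :=
          Finset.sum_le_sum fun i _ => Finset.sum_le_sum fun j _ => hM i j
      _ = (#Q : ℝ) ^ 2 + #Q * C := by
          simp [Finset.sum_add_distrib, sq, Finset.sum_ite_mem]
  have hclose : ∑ i ∈ Q, ∑ j ∈ Q, ∑ l ∈ B, μ l * (u l i - u l j) ^ 2 ≤ (#Q : ℝ) ^ 2 * ε :=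
    calc _ ≤ ∑ i ∈ Q, ∑ j ∈ Q, ε :=
          Finset.sum_le_sum fun i hi => Finset.sum_le_sum fun j hj => hQ i hi j hj
      _ = (#Q : ℝ) ^ 2 * ε := by simp; ring
  have hexp : ∑ i ∈ Q, ∑ j ∈ Q, ∑ l ∈ B, μ l * (u l i - u l j) ^ 2 =
      2 * #Q * T - 2 * ∑ i ∈ Q, ∑ j ∈ Q, ∑ l ∈ B, μ l * (u l i * u l j) := by
    have h1 : ∀ i j, ∑ l ∈ B, μ l * (u l i - u l j) ^ 2 = ∑ l ∈ B, μ l * (u l i * u l i) +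
        ∑ l ∈ B, μ l * (u l j * u l j) - 2 * ∑ l ∈ B, μ l * (u l i * u l j) := by
      intro i j
      rw [Finset.mul_sum, ← Finset.sum_add_distrib, ← Finset.sum_sub_distrib]
      exact Finset.sum_congr rfl fun l _ => by ring
    simp only [h1, Finset.sum_add_distrib, Finset.sum_sub_distrib, Finset.sum_const,
      nsmul_eq_mul, ← Finset.mul_sum, ← hT]
    ring
  have h2 : (#Q : ℝ) * T ≤ #Q * (#Q * (1 + ε / 2) + C) := by nlinarith
  exact le_of_mul_le_mul_left h2 hpos

/-- A bounded number of eigenvalues of a positive semidefinite matrix with entries at most `1` off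
the diagonal has sum at most `(1 + ε / 2) n + O(1)`, however large the diagonal is. -/
theorem sum_le_of_card_le {μ : ι → ℝ} {u : ι → ι → ℝ} {B : Finset ι} {C ε η : ℝ} {m r : ℕ}
    (hC : 0 ≤ C) (hμ : ∀ l, 0 ≤ μ l)
    (hu : ∀ l m, ∑ i, u l i * u m i = if l = m then 1 else 0)
    (hM : ∀ i j, ∑ l, μ l * (u l i * u l j) ≤ 1 + if i = j then C else 0)
    (hB : #B ≤ r) (hη : 0 < η) (hηε : r * η ^ 2 ≤ ε) (hm : (1 + C) / η ≤ m) :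
    ∑ l ∈ B, μ l ≤ Fintype.card ι * (1 + ε / 2) + C * (2 * m + 1) ^ r := by
  -- A grid of side `η` cuts the vectors `x i` into clusters. The diagonal bounds each coordinate,
  -- so the number of cells does not depend on `n`.
  set cell : ι → B → ℤ := fun i l => ⌊√(μ l) * u l i / η⌋ with hcell
  set T : Finset (B → ℤ) := Fintype.piFinset fun _ => Finset.Icc (-(m : ℤ)) m with hT
  have hmaps : ∀ i ∈ (univ : Finset ι), cell i ∈ T := by
    intro i _
    rw [hT, Fintype.mem_piFinset]
    intro l
    have h1 : (√(μ l) * u l i) ^ 2 ≤ 1 + C := by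
      have h2 := hM i i
      rw [if_pos rfl] at h2
      refine le_trans ?_ h2
      rw [mul_pow, Real.sq_sqrt (hμ l), sq]
      exact Finset.single_le_sum (f := fun l => μ l * (u l i * u l i))
        (fun l _ => mul_nonneg (hμ l) (mul_self_nonneg _)) (Finset.mem_univ (l : ι))
    have h2 : |√(μ l) * u l i| ≤ 1 + C := abs_le_of_sq_le_sq (by nlinarith) (by linarith)
    have h3 : |√(μ l) * u l i / η| ≤ m := by
      rw [abs_div, abs_of_pos hη]
      exact le_trans (by gcongr) hm
    rw [abs_le] at h3
    rw [Finset.mem_Icc]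
    refine ⟨Int.le_floor.2 (by exact_mod_cast h3.1), ?_⟩
    exact_mod_cast (Int.floor_le _).trans h3.2
  have hTcard : (#T : ℝ) ≤ (2 * m + 1) ^ r := by
    have h1 : #T = (2 * m + 1) ^ #B := by
      rw [hT, Fintype.card_piFinset]
      simp only [Int.card_Icc, Finset.prod_const, Finset.card_univ, Fintype.card_coe]
      congr 1
      omega
    rw [h1]
    have h2 : (2 * m + 1) ^ #B ≤ (2 * m + 1) ^ r := Nat.pow_le_pow_right (by omega) hB
    exact_mod_cast h2
  rw [← sum_diag_of_orthonormal hu, ← Finset.sum_fiberwise_of_maps_to hmaps]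
  calc ∑ q ∈ T, ∑ i with cell i = q, ∑ l ∈ B, μ l * (u l i * u l i)
      ≤ ∑ q ∈ T, (#{i | cell i = q} * (1 + ε / 2) + C) := by
        refine Finset.sum_le_sum fun q _ => sum_diag_le_of_close hC hμ hM fun i hi j hj => ?_
        rw [Finset.mem_filter] at hi hj
        calc ∑ l ∈ B, μ l * (u l i - u l j) ^ 2 ≤ ∑ l ∈ B, η ^ 2 := by
              refine Finset.sum_le_sum fun l hl => ?_
              have h1 : cell i ⟨l, hl⟩ = cell j ⟨l, hl⟩ := by rw [hi.2, hj.2]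
              have h2 := Int.abs_sub_lt_one_of_floor_eq_floor h1
              rw [← sub_div, abs_div, abs_of_pos hη, div_lt_one hη] at h2
              have h3 : (√(μ l) * u l i - √(μ l) * u l j) ^ 2 ≤ η ^ 2 :=
                sq_le_sq' (by linarith [(abs_lt.1 h2).1]) (abs_lt.1 h2).2.le
              rwa [← mul_sub, mul_pow, Real.sq_sqrt (hμ l)] at h3
          _ = #B * η ^ 2 := by simp
          _ ≤ r * η ^ 2 := by gcongr
          _ ≤ ε := hηε
    _ = Fintype.card ι * (1 + ε / 2) + C * #T := by
        rw [Finset.sum_add_distrib, ← Finset.sum_mul, ← Nat.cast_sum,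
          ← Finset.card_eq_sum_card_fiberwise hmaps, Finset.card_univ, Finset.sum_const,
          nsmul_eq_mul, mul_comm C]
    _ ≤ _ := by gcongr

end LargeEigenvalues

/-! ### Rank one approximation of sign matrices. -/

section SignMatrix

open Finset

universe v

/-- At a disagreement, `Z i j = ±1` and `a * (v i * v j)` has the opposite sign or vanishes, so the
squared error is at least 1. The diagonal never disagrees. -/
theorem card_sign_ne_le {ι : Type*} [Fintype ι] [DecidableEq ι] {S Z : ι → ι → ℝ}
    (hS : ∀ i j, S i j = 1 ∨ S i j = -1) (hS1 : ∀ i, S i i = 1) {a : ℝ} (ha : 0 ≤ a) (v : ι → ℝ)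
    (hZ : ∀ i j, i ≠ j → S i j = Z i j) :
    (#{p : ι × ι | S p.1 p.2 ≠ if (p.1 ∈ ({i | 0 ≤ v i} : Finset ι) ↔
        p.2 ∈ ({i | 0 ≤ v i} : Finset ι)) then 1 else -1} : ℝ) ≤
      ∑ i, ∑ j, (Z i j - a * (v i * v j)) ^ 2 := by
  rw [← Finset.sum_boole, ← Fintype.sum_prod_type']
  refine Finset.sum_le_sum fun p _ => ?_
  obtain ⟨i, j⟩ := p
  simp only [Finset.mem_filter, Finset.mem_univ, true_and]
  split_ifs with h2 h1 h1
  · have h3 : S i j = -1 := (hS i j).resolve_left h1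
    have hij : i ≠ j := by
      rintro rfl
      exact h1 (hS1 i)
    rw [← hZ i j hij, h3]
    have h4 : 0 ≤ a * (v i * v j) := by
      refine mul_nonneg ha ?_
      by_cases h5 : 0 ≤ v i
      · exact mul_nonneg h5 (h2.1 h5)
      · exact mul_nonneg_of_nonpos_of_nonpos (le_of_not_ge h5)
          (le_of_not_ge fun h6 => h5 (h2.2 h6))
    nlinarith
  · exact sq_nonneg _
  · have h3 : S i j = 1 := (hS i j).resolve_right h1
    have hij : i ≠ j := by
      rintro rfl
      exact h2 Iff.rfl
    rw [← hZ i j hij, h3]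
    have h4 : a * (v i * v j) ≤ 0 := by
      refine mul_nonpos_of_nonneg_of_nonpos ha ?_
      by_cases h5 : 0 ≤ v i
      · exact mul_nonpos_of_nonneg_of_nonpos h5
          (le_of_not_ge fun h6 => h2 ⟨fun _ => h6, fun _ => h5⟩)
      · refine mul_nonpos_of_nonpos_of_nonneg (le_of_not_ge h5) ?_
        by_contra h6
        exact h2 ⟨fun h => absurd h h5, fun h => absurd h h6⟩
    nlinarith
  · exact sq_nonneg _

/-- A large symmetric sign matrix whose eigenvalues are at least `-C` agrees with a rank one sign
matrix in almost all entries. -/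
theorem exists_rank_one_sign_approx {C δ : ℝ} (hC : 0 ≤ C) (hδ : 0 < δ) :
    ∃ N : ℕ, ∀ (ι : Type v) [Fintype ι] [DecidableEq ι] (S : ι → ι → ℝ) (μ : ι → ℝ)
      (u : ι → ι → ℝ), N ≤ Fintype.card ι → (∀ i, S i i = 1) → (∀ i j, S i j = 1 ∨ S i j = -1) →
      (∀ l, 0 ≤ μ l) → (∀ l m, ∑ i, u l i * u m i = if l = m then 1 else 0) →
      (∀ i j, S i j + (if i = j then C else 0) = ∑ l, μ l * (u l i * u l j)) →
      ∃ P : Finset ι, (#{p : ι × ι | S p.1 p.2 ≠ if (p.1 ∈ P ↔ p.2 ∈ P) then 1 else -1} : ℝ)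
        ≤ δ * (Fintype.card ι : ℝ) ^ 2 := by
  -- The top eigenvalue will be at least `n(1 - ε(2 + C))`. Squaring loses at most `2ε(2 + C)n² ≤
  -- δn²/2`; the other half of `δ` absorbs the diagonal.
  obtain ⟨ε, hε, hε1, hεδ⟩ : ∃ ε : ℝ, 0 < ε ∧ ε * (2 + C) ≤ 1 ∧ 4 * (ε * (2 + C)) ≤ δ := by
    refine ⟨min 1 (δ / 4) / (2 + C), by positivity, ?_, ?_⟩
    · rw [div_mul_cancel₀ _ (by positivity)]
      exact min_le_left _ _
    · rw [div_mul_cancel₀ _ (by positivity)]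
      linarith [min_le_right 1 (δ / 4)]
  have hε2 : ε ≤ 1 := by nlinarith
  set r : ℕ := ⌈(1 + C) / ε⌉₊ with hr
  set η : ℝ := ε / (r + 1) with hη
  have hηpos : 0 < η := by positivity
  have hηε : r * η ^ 2 ≤ ε := by
    have h1 : η * (r + 1) = ε := div_mul_cancel₀ _ (by positivity)
    have h2 : η ≤ 1 := by nlinarith [(Nat.cast_nonneg r : (0 : ℝ) ≤ r)]
    nlinarith [mul_nonneg (Nat.cast_nonneg r : (0 : ℝ) ≤ r) hηpos.le]
  set m : ℕ := ⌈(1 + C) / η⌉₊ with hm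
  set K : ℝ := (2 * m + 1) ^ r with hK
  obtain ⟨N, hN⟩ := exists_nat_ge (max 1 (max (2 * (C * K) / ε) (2 * (2 * C + C ^ 2) / δ)))
  refine ⟨N, fun ι _ _ S μ u hn hS1 hS hμ hu hM => ?_⟩
  set n : ℝ := ((Fintype.card ι : ℕ) : ℝ) with hn_def
  have hNn : (N : ℝ) ≤ n := Nat.cast_le.2 hn
  have hn1 : 1 ≤ n := (le_max_left _ _).trans (hN.trans hNn)
  have hnK : 2 * (C * K) ≤ n * ε := by
    rw [← div_le_iff₀ hε]
    exact (((le_max_left _ _).trans (le_max_right _ _)).trans hN).trans hNn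
  have hnδ : 2 * (2 * C + C ^ 2) ≤ n * δ := by
    rw [← div_le_iff₀ hδ]
    exact (((le_max_right _ _).trans (le_max_right _ _)).trans hN).trans hNn
  have hSsq : ∀ i j, S i j ^ 2 = 1 := fun i j => by rcases hS i j with h | h <;> rw [h] <;> norm_num
  have htrace : ∑ l, μ l = n * (1 + C) := by
    rw [← sum_diag_of_orthonormal hu]
    simp only [← hM, hS1, if_true, Finset.sum_const, Finset.card_univ, nsmul_eq_mul, ← hn_def]
  have hfrob : ∑ l, μ l ^ 2 = n ^ 2 + n * (2 * C + C ^ 2) := by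
    rw [← sum_sq_sum_mul_of_orthonormal hu]
    have h1 : ∀ i j, (∑ l, μ l * (u l i * u l j)) ^ 2 =
        1 + if i = j then 2 * C + C ^ 2 else 0 := by
      intro i j
      rw [← hM]
      split_ifs with h
      · rw [h, hS1]; ring
      · rw [add_zero, hSsq, add_zero]
    simp only [h1, Finset.sum_add_distrib, Finset.sum_ite_eq, Finset.mem_univ, if_true,
      Finset.sum_const, Finset.card_univ, nsmul_eq_mul, ← hn_def]
    ring
  set B : Finset ι := {l | ε * n ≤ μ l} with hB
  have hBcard : #B ≤ r := by
    have h1 : #B * (ε * n) ≤ n * (1 + C) :=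
      calc #B * (ε * n) = ∑ l ∈ B, ε * n := by simp
        _ ≤ ∑ l ∈ B, μ l := Finset.sum_le_sum fun l hl => (Finset.mem_filter.1 hl).2
        _ ≤ ∑ l, μ l := Finset.sum_le_sum_of_subset_of_nonneg (Finset.subset_univ _)
            fun l _ _ => hμ l
        _ = n * (1 + C) := htrace
    have h2 : (#B : ℝ) ≤ (1 + C) / ε := by
      rw [le_div_iff₀ hε]
      exact le_of_mul_le_mul_left (by linarith) (by linarith : 0 < n)
    exact_mod_cast h2.trans (Nat.le_ceil _)
  have hBsum : ∑ l ∈ B, μ l ≤ n * (1 + ε) := by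
    have h1 := sum_le_of_card_le hC hμ hu (fun i j => by
      rw [← hM]
      have : S i j ≤ 1 := by rcases hS i j with h | h <;> rw [h]; norm_num
      linarith) hBcard hηpos hηε (Nat.le_ceil _)
    rw [← hm, ← hK, ← hn_def] at h1
    linarith
  have hne : (univ : Finset ι).Nonempty := by
    rw [← Finset.card_pos, Finset.card_univ]
    have : (0 : ℝ) < Fintype.card ι := by linarith
    exact_mod_cast this
  obtain ⟨l₀, -, hl₀⟩ := Finset.exists_max_image univ μ hne
  have hsmall : ∑ l ∈ Bᶜ, μ l ^ 2 ≤ ε * n * (n * (1 + C)) := by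
    calc ∑ l ∈ Bᶜ, μ l ^ 2 ≤ ∑ l ∈ Bᶜ, ε * n * μ l := by
          refine Finset.sum_le_sum fun l hl => ?_
          have h1 : μ l ≤ ε * n := by
            rw [Finset.mem_compl, hB, Finset.mem_filter] at hl
            exact le_of_not_ge fun h => hl ⟨Finset.mem_univ _, h⟩
          rw [sq]
          exact mul_le_mul_of_nonneg_right h1 (hμ l)
      _ = ε * n * ∑ l ∈ Bᶜ, μ l := by rw [Finset.mul_sum]
      _ ≤ ε * n * ∑ l, μ l := by
          refine mul_le_mul_of_nonneg_left ?_ (by positivity)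
          exact Finset.sum_le_sum_of_subset_of_nonneg (Finset.subset_univ _) fun l _ _ => hμ l
      _ = _ := by rw [htrace]
  have hlarge : ∑ l ∈ B, μ l ^ 2 ≤ μ l₀ * (n * (1 + ε)) := by
    calc ∑ l ∈ B, μ l ^ 2 ≤ ∑ l ∈ B, μ l₀ * μ l := by
          refine Finset.sum_le_sum fun l _ => ?_
          rw [sq]
          exact mul_le_mul_of_nonneg_right (hl₀ l (Finset.mem_univ _)) (hμ l)
      _ = μ l₀ * ∑ l ∈ B, μ l := by rw [Finset.mul_sum]
      _ ≤ _ := mul_le_mul_of_nonneg_left hBsum (hμ _)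
  have hsplit := Finset.sum_add_sum_compl B fun l => μ l ^ 2
  -- Compare `n² ≤ ∑ μ²` with the bounds on the small and the large part.
  have hmax : n * (1 - ε * (2 + C)) ≤ μ l₀ := by
    have h1 : n * (n * (1 - ε * (1 + C))) ≤ n * (μ l₀ * (1 + ε)) := by
      nlinarith [mul_nonneg (by linarith : 0 ≤ n) (by positivity : 0 ≤ 2 * C + C ^ 2)]
    have h2 := le_of_mul_le_mul_left h1 (by linarith)
    have h3 : n * (1 - ε * (2 + C)) * (1 + ε) ≤ μ l₀ * (1 + ε) := by
      refine le_trans ?_ h2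
      have : 0 ≤ n * (ε ^ 2 * (2 + C)) := by positivity
      nlinarith
    exact le_of_mul_le_mul_right h3 (by linarith)
  have hmaxsq : n ^ 2 * (1 - 2 * (ε * (2 + C))) ≤ μ l₀ ^ 2 := by
    have h1 : (n * (1 - ε * (2 + C))) ^ 2 ≤ μ l₀ ^ 2 :=
      pow_le_pow_left₀ (mul_nonneg (by linarith) (by linarith)) hmax 2
    nlinarith [sq_nonneg (n * (ε * (2 + C)))]
  have hres : ∑ i, ∑ j, (∑ l, μ l * (u l i * u l j) - μ l₀ * (u l₀ i * u l₀ j)) ^ 2 =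
      ∑ l, μ l ^ 2 - μ l₀ ^ 2 := by
    have h1 := sum_sq_sum_mul_of_orthonormal hu fun l => if l = l₀ then 0 else μ l
    have h2 : ∀ f : ι → ℝ, ∑ l, (if l = l₀ then 0 else μ l) * f l =
        ∑ l, μ l * f l - μ l₀ * f l₀ := by
      intro f
      rw [← Finset.add_sum_erase univ (fun l => μ l * f l) (Finset.mem_univ l₀),
        ← Finset.add_sum_erase univ _ (Finset.mem_univ l₀), if_pos rfl, zero_mul, zero_add,
        add_sub_cancel_left]
      exact Finset.sum_congr rfl fun l hl => by rw [if_neg (Finset.ne_of_mem_erase hl)]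
    have h3 : ∀ l, (if l = l₀ then 0 else μ l) ^ 2 = (if l = l₀ then 0 else μ l) * μ l := by
      intro l
      split_ifs <;> ring
    simp only [h2, h3] at h1
    rw [h1, ← sq]
    simp only [sq]
  refine ⟨({i | 0 ≤ u l₀ i} : Finset ι), ?_⟩
  refine (card_sign_ne_le hS hS1 (hμ l₀) (u l₀)
    (Z := fun i j => ∑ l, μ l * (u l i * u l j)) fun i j hij => ?_).trans ?_
  · rw [← hM, if_neg hij, add_zero]
  · rw [hres, hfrob]
    linarith [mul_le_mul_of_nonneg_left hεδ (sq_nonneg n),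
      mul_le_mul_of_nonneg_left hnδ (by linarith : 0 ≤ n)]

end SignMatrix

/-! ### From a sign pattern to a balanced bipartition. -/

section EdgeDifference

open Finset

theorem edgeDifference_le_card {V W : Type*} {G : SimpleGraph V} {H : SimpleGraph W}
    {e : V ≃ W} (D : Finset (V × V))
    (hD : ∀ i j, ¬(G.Adj i j ↔ H.Adj (e i) (e j)) → (i, j) ∈ D) :
    edgeDifference G H e ≤ #D := by
  classical
  have hsub : G.edgeSet ∆ (H.comap e).edgeSet ⊆ (D.image fun p => s(p.1, p.2) : Finset (Sym2 V)) := by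
    intro z
    induction z using Sym2.ind with
    | _ i j =>
      intro hz
      rw [Finset.mem_coe, Finset.mem_image]
      refine ⟨(i, j), hD i j fun h => ?_, rfl⟩
      rw [Set.mem_symmDiff, SimpleGraph.mem_edgeSet, SimpleGraph.mem_edgeSet,
        SimpleGraph.comap_adj] at hz
      tauto
  calc edgeDifference G H e ≤ #(D.image fun p => s(p.1, p.2)) := by
        rw [← Set.ncard_coe_finset]
        exact Set.ncard_le_ncard hsub (Finset.finite_toSet _)
    _ ≤ #D := Finset.card_image_le

variable {V : Type*} [Fintype V] [DecidableEq V]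

theorem exists_equiv_sum_fin {d : ℕ} (hd : 2 * d = Fintype.card V) {P : Finset V} (hP : #P = d) :
    ∃ e : V ≃ Fin d ⊕ Fin d, ∀ i, (e i).isLeft = true ↔ i ∈ P := by
  have h1 : Fintype.card {i // i ∈ P} = d := by rw [Fintype.card_coe, hP]
  have h2 : Fintype.card {i // i ∉ P} = d := by
    rw [Fintype.card_subtype_compl, h1]
    omega
  refine ⟨(Equiv.sumCompl (· ∈ P)).symm.trans
    ((Fintype.equivFinOfCardEq h1).sumCongr (Fintype.equivFinOfCardEq h2)), fun i => ?_⟩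
  by_cases hi : i ∈ P
  · simp [hi, Equiv.sumCompl_symm_apply_of_pos]
  · simp [hi, Equiv.sumCompl_symm_apply_of_neg]

theorem completeBipartiteGraph_adj_iff_isLeft {α β : Type*} (x y : α ⊕ β) :
    (completeBipartiteGraph α β).Adj x y ↔ ¬(x.isLeft = true ↔ y.isLeft = true) := by
  cases x <;> cases y <;> simp

theorem exists_card_eq_symmDiff {d : ℕ} (hd : d ≤ Fintype.card V) (P : Finset V) :
    ∃ Q : Finset V, #Q = d ∧ (#(P ∆ Q) : ℝ) = |(#P : ℝ) - d| := by
  rcases le_total d #P with h | h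
  · obtain ⟨Q, hQP, hQ⟩ := Finset.exists_subset_card_eq h
    refine ⟨Q, hQ, ?_⟩
    rw [symmDiff_of_ge hQP, Finset.cast_card_sdiff hQP, hQ, abs_of_nonneg]
    rw [sub_nonneg]
    exact_mod_cast h
  · obtain ⟨Q, hPQ, -, hQ⟩ := Finset.exists_subsuperset_card_eq (Finset.subset_univ P) h
      (by rwa [Finset.card_univ])
    refine ⟨Q, hQ, ?_⟩
    rw [symmDiff_of_le hPQ, Finset.cast_card_sdiff hPQ, hQ, abs_of_nonpos, neg_sub]
    rw [sub_nonpos]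
    exact_mod_cast h

/-- The entries of `J - 2A` sum to zero, those of the pattern of `P` to `(2(#P - d))²`, and each
disagreement accounts for at most 2. Hence `P` is within `sn` of size `d`, and correcting it affects
at most `2sn²` ordered pairs. -/
theorem exists_edgeDifference_completeBipartiteGraph_le (G : SimpleGraph V) [DecidableRel G.Adj]
    {d : ℕ} (hd : 2 * d = Fintype.card V) (hG : G.IsRegularOfDegree d) {s : ℝ} (hs : 0 ≤ s)
    {P : Finset V}
    (hP : (#{p : V × V | 1 - 2 * G.adjMatrix ℝ p.1 p.2 ≠
      if (p.1 ∈ P ↔ p.2 ∈ P) then 1 else -1} : ℝ) ≤ 2 * s ^ 2 * (Fintype.card V : ℝ) ^ 2) :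
    ∃ e : V ≃ Fin d ⊕ Fin d,
      (edgeDifference G (completeBipartiteGraph (Fin d) (Fin d)) e : ℝ) ≤
        (2 * s ^ 2 + 2 * s) * (Fintype.card V : ℝ) ^ 2 := by
  set M : Finset (V × V) := {p : V × V | 1 - 2 * G.adjMatrix ℝ p.1 p.2 ≠
      if (p.1 ∈ P ↔ p.2 ∈ P) then 1 else -1} with hM
  have hcard : (Fintype.card V : ℝ) = 2 * d := by rw [← hd]; push_cast; ring
  have hrow : ∀ i, ∑ j, (1 - 2 * G.adjMatrix ℝ i j) = 0 := by
    intro i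
    have h1 : ∑ j, G.adjMatrix ℝ i j = d := by
      have := G.adjMatrix_mulVec_const_apply_of_regular (α := ℝ) (a := 1) hG (v := i)
      simpa [Matrix.mulVec, dotProduct] using this
    rw [Finset.sum_sub_distrib, ← Finset.mul_sum, h1]
    simp [hcard]
  have hx : ∑ i, (if i ∈ P then 1 else -1 : ℝ) = 2 * (#P - d) := by
    have h1 : ∀ i, (if i ∈ P then 1 else -1 : ℝ) = 2 * (if i ∈ P then 1 else 0) - 1 := by
      intro i
      split_ifs <;> norm_num
    simp only [h1, Finset.sum_sub_distrib, ← Finset.mul_sum]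
    simp [hcard]
    ring
  have hprod : ∑ p : V × V, (if (p.1 ∈ P ↔ p.2 ∈ P) then 1 else -1 : ℝ) = (2 * (#P - d)) ^ 2 := by
    rw [← hx, sq, Finset.sum_mul_sum, Fintype.sum_prod_type]
    refine Finset.sum_congr rfl fun i _ => Finset.sum_congr rfl fun j _ => ?_
    by_cases hi : i ∈ P <;> by_cases hj : j ∈ P <;> simp [hi, hj]
  have hbal : (2 * ((#P : ℝ) - d)) ^ 2 ≤ 2 * #M := by
    have h1 : ∑ p : V × V, (1 - 2 * G.adjMatrix ℝ p.1 p.2) = 0 := by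
      rw [Fintype.sum_prod_type]
      exact Finset.sum_eq_zero fun i _ => hrow i
    rw [← hprod, ← sub_zero (∑ p : V × V, _), ← h1, ← Finset.sum_sub_distrib, hM,
      ← Finset.sum_boole, Finset.mul_sum]
    refine Finset.sum_le_sum fun p _ => ?_
    have h2 : -1 ≤ 1 - 2 * G.adjMatrix ℝ p.1 p.2 := by
      rw [SimpleGraph.adjMatrix_apply]
      split_ifs <;> norm_num
    split_ifs with h3 h4 h4 <;> simp_all <;> linarith
  have hdev : |(#P : ℝ) - d| ≤ s * Fintype.card V := by
    refine abs_le_of_sq_le_sq ?_ (by positivity)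
    nlinarith
  obtain ⟨Q, hQ, hPQ⟩ := exists_card_eq_symmDiff (by omega : d ≤ Fintype.card V) P
  obtain ⟨e, he⟩ := exists_equiv_sum_fin hd hQ
  refine ⟨e, ?_⟩
  have hle := edgeDifference_le_card (G := G) (H := completeBipartiteGraph (Fin d) (Fin d)) (e := e)
    (M ∪ ((P ∆ Q) ×ˢ univ ∪ univ ×ˢ (P ∆ Q))) fun i j hij => by
      by_contra hmem
      simp only [Finset.mem_union, Finset.mem_product, Finset.mem_univ, and_true, true_and,
        not_or, Finset.mem_symmDiff, hM, Finset.mem_filter, not_not] at hmem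
      obtain ⟨h1, h2, h3⟩ := hmem
      rw [completeBipartiteGraph_adj_iff_isLeft, he, he] at hij
      rw [SimpleGraph.adjMatrix_apply] at h1
      have h4 : (i ∈ P ↔ i ∈ Q) := by tauto
      have h5 : (j ∈ P ↔ j ∈ Q) := by tauto
      rw [← h4, ← h5] at hij
      apply hij
      split_ifs at h1 with h6 h7 h7
      · norm_num at h1
      · exact iff_of_true h6 h7
      · exact iff_of_false h6 (not_not.2 h7)
      · norm_num at h1
  calc (edgeDifference G (completeBipartiteGraph (Fin d) (Fin d)) e : ℝ)
      ≤ #(M ∪ ((P ∆ Q) ×ˢ univ ∪ univ ×ˢ (P ∆ Q))) := by exact_mod_cast hle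
    _ ≤ #M + (#(P ∆ Q) * Fintype.card V + Fintype.card V * #(P ∆ Q)) := by
        have h1 := Finset.card_union_le M ((P ∆ Q) ×ˢ univ ∪ univ ×ˢ (P ∆ Q))
        have h2 := Finset.card_union_le ((P ∆ Q) ×ˢ (univ : Finset V)) (univ ×ˢ (P ∆ Q))
        rw [Finset.card_product, Finset.card_product, Finset.card_univ] at h2
        exact_mod_cast h1.trans (Nat.add_le_add_left h2 _)
    _ ≤ 2 * s ^ 2 * (Fintype.card V : ℝ) ^ 2 + (s * Fintype.card V * Fintype.card V +
          Fintype.card V * (s * Fintype.card V)) := by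
        rw [hPQ]
        gcongr
    _ = _ := by ring

end EdgeDifference

/-! ### Assembling the bound. -/

section AlmostBipartite

universe v

theorem eventually_exists_edgeDifference_le (c : ℝ) {ε : ℝ} (hε : 0 < ε) :
    ∃ N : ℕ, ∀ (V : Type v) [Fintype V] [DecidableEq V] (G : SimpleGraph V) [DecidableRel G.Adj]
      (hV : 1 < Fintype.card V) (d : ℕ), N ≤ Fintype.card V → 2 * d = Fintype.card V →
      G.IsRegularOfDegree d → secondEigenvalue G hV ≤ c →
        ∃ e : V ≃ Fin d ⊕ Fin d,
          (edgeDifference G (completeBipartiteGraph (Fin d) (Fin d)) e : ℝ)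
            ≤ ε * (Fintype.card V : ℝ) ^ 2 := by
  obtain ⟨s, hs, hs1, hsε⟩ : ∃ s : ℝ, 0 < s ∧ s ≤ 1 ∧ 4 * s ≤ ε :=
    ⟨min 1 (ε / 4), by positivity, min_le_left _ _, by linarith [min_le_right 1 (ε / 4)]⟩
  have hC : 0 ≤ 2 * |c| := by positivity
  obtain ⟨N, hN⟩ := exists_rank_one_sign_approx.{v} hC (by positivity : 0 < 2 * s ^ 2)
  -- Guarantees `c < d`, which separates the degree from all other eigenvalues.
  obtain ⟨N', hN'⟩ := exists_nat_gt (2 * c)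
  refine ⟨max N N', fun V _ _ G _ hV d hn hd hG hc => ?_⟩
  have hcd : c < d := by
    have h1 : (N' : ℝ) ≤ 2 * d := by exact_mod_cast hd ▸ (le_max_right _ _).trans hn
    linarith
  obtain ⟨μ, u, hμ, hu, hM⟩ := exists_spectral_decomposition_of_secondEigenvalue_le G hV hd hG hc
    hcd hC (by linarith [le_abs_self c])
  obtain ⟨P, hP⟩ := hN V (fun i j => 1 - 2 * G.adjMatrix ℝ i j) μ u ((le_max_left _ _).trans hn)
    (fun i => by simp) (fun i j => by
      rw [SimpleGraph.adjMatrix_apply]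
      split_ifs <;> norm_num) hμ hu hM
  obtain ⟨e, he⟩ := exists_edgeDifference_completeBipartiteGraph_le G hd hG hs.le hP
  exact ⟨e, he.trans (mul_le_mul_of_nonneg_right (by nlinarith) (by positivity))⟩

end AlmostBipartite

theorem theorem5 (c : ℝ) :
    ∃ f : ℕ → ℝ, (f =o[atTop] fun n : ℕ => (n : ℝ) ^ 2) ∧
      ∀ (V : Type*) [Fintype V] [DecidableEq V] (G : SimpleGraph V) [DecidableRel G.Adj]
        (hV : 1 < Fintype.card V) (d : ℕ),
        2 * d = Fintype.card V → G.IsRegularOfDegree d → secondEigenvalue G hV ≤ c →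
          ∃ e : V ≃ Fin d ⊕ Fin d,
            (edgeDifference G (completeBipartiteGraph (Fin d) (Fin d)) e : ℝ)
              ≤ f (Fintype.card V) := by
  -- `f n` is the least bound valid for all such graphs on `n` vertices. The trivial bound `n²`
  -- keeps the set nonempty, so `sInf` is attained.
  set A : ℕ → Set ℕ := fun n => {k | ∀ (V : Type _) [Fintype V] [DecidableEq V]
    (G : SimpleGraph V) [DecidableRel G.Adj] (hV : 1 < Fintype.card V) (d : ℕ),
    Fintype.card V = n → 2 * d = Fintype.card V → G.IsRegularOfDegree d →
    secondEigenvalue G hV ≤ c → ∃ e : V ≃ Fin d ⊕ Fin d,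
      edgeDifference G (completeBipartiteGraph (Fin d) (Fin d)) e ≤ k} with hA
  have hne : ∀ n, (A n).Nonempty := by
    intro n
    refine ⟨n * n, fun V _ _ G _ hV d hn hd _ _ => ?_⟩
    obtain ⟨e⟩ : Nonempty (V ≃ Fin d ⊕ Fin d) := by
      rw [← Fintype.card_eq]
      simp [← hd, two_mul]
    refine ⟨e, (edgeDifference_le_card Finset.univ fun _ _ _ => Finset.mem_univ _).trans ?_⟩
    rw [Finset.card_univ, Fintype.card_prod, hn]
  refine ⟨fun n => (sInf (A n) : ℕ), ?_, fun V _ _ G _ hV d hd hG hc => ?_⟩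
  · rw [isLittleO_iff]
    intro ε hε
    obtain ⟨N, hN⟩ := eventually_exists_edgeDifference_le c hε
    filter_upwards [eventually_ge_atTop N] with n hn
    have hmem : ⌊ε * (n : ℝ) ^ 2⌋₊ ∈ A n := by
      intro V _ _ G _ hV d hVn hd hG hc
      obtain ⟨e, he⟩ := hN V G hV d (hVn ▸ hn) hd hG hc
      exact ⟨e, Nat.le_floor (by rwa [hVn] at he)⟩
    have h1 : ((sInf (A n) : ℕ) : ℝ) ≤ ε * (n : ℝ) ^ 2 :=
      (Nat.cast_le.2 (Nat.sInf_le hmem)).trans (Nat.floor_le (by positivity))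
    rwa [Real.norm_of_nonneg (by positivity), Real.norm_of_nonneg (by positivity)]
  · obtain ⟨e, he⟩ := Nat.sInf_mem (hne (Fintype.card V)) V G hV d rfl hd hG hc
    exact ⟨e, Nat.cast_le.2 he⟩
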